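/- Let $R$ be a commutative noetherian complete local ring with maximal ideal $\mathfrak m$ and residue field $k=R/\mathfrak m$. Assume that $R$ is Gorenstein, i.e. $R$ has finite injective dimension as an $R$-module, and that $\dim R>0$. For an $R$-module $M$ let $E(M)$ denote its injective envelope. Then: (1) $E(R/\mathfrak q)\otimes_R E(k)=0$ for every prime ideal $\mathfrak q$ of $R$ of height $\operatorname{ht}(\mathfrak q)>0$. (2) Consequently, Kubik's question (if $L$ and $T$ are modules over a commutative noetherian local ring with $T$ quasidualizing and $T\otimes L=0$, is $L=0$?) has a negative answer over every such $R$: there are $R$-modules $T$ and $L$ such that $T$ is quasidualizing, $T\otimes_R L=0$ and $L\neq 0$. Here an $R$-module $T$ over a commutative noetherian local ring $(R,\mathfrak m)$ is called quasidualizing if it is artinian, the homothety map $\widehat R\to \operatorname{Hom}_R(T,T)$ is an isomorphism, where $\widehat R$ is the $\mathfrak m$-adic completion of $R$, and $\operatorname{Ext}^i_R(T,T)=0$ for all $i\geq 1$. -/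

import Mathlib

open scoped TensorProduct

universe u

/-- `ι : M → E` is an injective hull (injective envelope) of `M`: the module `E` is injective, `ι` is
a monomorphism, and `E` is an essential extension of the image of `ι`. -/
structure IsInjectiveHull {R M E : Type*} [CommRing R] [AddCommGroup M] [Module R M]
    [AddCommGroup E] [Module R E] (ι : M →ₗ[R] E) : Prop where
  module_injective : Module.Injective R E
  injective : Function.Injective ι
  essential : ∀ N : Submodule R E, N ⊓ LinearMap.range ι = ⊥ → N = ⊥

/-- Over a noetherian local ring, every element of an artinian module is annihilated by some power
of the maximal ideal. -/
theorem exists_maximalIdeal_pow_le_ker {R T : Type*} [CommRing R] [IsLocalRing R]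
    [IsNoetherianRing R] [AddCommGroup T] [Module R T] [IsArtinian R T] (t : T) :
    ∃ n : ℕ, IsLocalRing.maximalIdeal R ^ n ≤ LinearMap.ker (LinearMap.toSpanSingleton R T t) := by
  let m := IsLocalRing.maximalIdeal R
  let f : ℕ →o (Submodule R T)ᵒᵈ :=
    ⟨fun n => OrderDual.toDual (m ^ n • Submodule.span R {t}), fun a b hab =>
      Submodule.smul_mono_left (Ideal.pow_le_pow_right hab)⟩
  obtain ⟨n, hn⟩ := IsArtinian.monotone_stabilizes f
  have h1 : m ^ n • Submodule.span R {t} = m ^ (n + 1) • Submodule.span R {t} :=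
    hn (n + 1) (Nat.le_succ n)
  have h2 : m ^ n • Submodule.span R {t} = ⊥ := by
    refine Submodule.eq_bot_of_le_smul_of_le_jacobson_bot m _ ?_ ?_ ?_
    · exact Submodule.FG.smul (IsNoetherian.noetherian (m ^ n)) (Submodule.fg_span_singleton t)
    · rw [← Submodule.mul_smul, ← pow_succ']
      exact h1.le
    · exact IsLocalRing.maximalIdeal_le_jacobson ⊥
  refine ⟨n, fun a ha => ?_⟩
  rw [LinearMap.mem_ker, LinearMap.toSpanSingleton_apply, ← Submodule.mem_bot R, ← h2]
  exact Submodule.smul_mem_smul ha (Submodule.mem_span_singleton_self t)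

noncomputable section

/-- The scalar action of `x` in the `𝔪`-adic completion of `R` on `t` in an artinian module `T`:
choose `n` with `𝔪 ^ n • t = 0` and let the residue class of `x` in `R ⧸ 𝔪 ^ n` act on `t`. -/
def completionSMul {R T : Type*} [CommRing R] [IsLocalRing R] [IsNoetherianRing R]
    [AddCommGroup T] [Module R T] [IsArtinian R T]
    (x : AdicCompletion (IsLocalRing.maximalIdeal R) R) (t : T) : T :=
  Submodule.liftQ (IsLocalRing.maximalIdeal R ^ (exists_maximalIdeal_pow_le_ker (R := R) t).choose)
    (LinearMap.toSpanSingleton R T t) (exists_maximalIdeal_pow_le_ker (R := R) t).choose_spec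
    (AdicCompletion.evalₐ (IsLocalRing.maximalIdeal R) _ x)

/-- The action does not depend on choices: if `𝔪 ^ n • t = 0` and `r` represents the class of `x`
modulo `𝔪 ^ n`, then `x` acts on `t` as `r` does. -/
theorem completionSMul_eq {R T : Type*} [CommRing R] [IsLocalRing R] [IsNoetherianRing R]
    [AddCommGroup T] [Module R T] [IsArtinian R T]
    (x : AdicCompletion (IsLocalRing.maximalIdeal R) R) (t : T) (n : ℕ) (r : R)
    (hn : ∀ a ∈ IsLocalRing.maximalIdeal R ^ n, a • t = 0)
    (hr : AdicCompletion.evalₐ (IsLocalRing.maximalIdeal R) n x =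
      Ideal.Quotient.mk (IsLocalRing.maximalIdeal R ^ n) r) :
    completionSMul x t = r • t := by
  obtain ⟨a, rfl⟩ := AdicCompletion.mk_surjective (IsLocalRing.maximalIdeal R) R x
  have key : ∀ k
      (hk : IsLocalRing.maximalIdeal R ^ k ≤ LinearMap.ker (LinearMap.toSpanSingleton R T t)),
      Submodule.liftQ (IsLocalRing.maximalIdeal R ^ k) (LinearMap.toSpanSingleton R T t) hk
        (AdicCompletion.evalₐ (IsLocalRing.maximalIdeal R) k (AdicCompletion.mk _ R a)) =
          r • t := by
    intro k hk
    have hsub : ∀ i ≤ max k n,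
        Ideal.Quotient.mk (IsLocalRing.maximalIdeal R ^ i) (a i) =
          Ideal.Quotient.mk (IsLocalRing.maximalIdeal R ^ i) (a (max k n)) := by
      intro i hi
      have h := a.property hi
      rw [SModEq.sub_mem] at h
      simpa [Ideal.Quotient.eq] using h
    rw [AdicCompletion.evalₐ_mk] at hr ⊢
    have hk' := hsub k (le_max_left k n)
    have hn' := hsub n (le_max_right k n)
    have h0 : (a (max k n) - r) • t = 0 := hn _ (Ideal.Quotient.eq.mp (hn'.symm.trans hr))
    refine (congrArg _ hk').trans ?_
    change a (max k n) • t = r • t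
    rwa [sub_smul, sub_eq_zero] at h0
  exact key _ _

/-- The homothety map `R̂ → Hom_R(T, T)` of an artinian module `T` over a noetherian local ring `R`
with `𝔪`-adic completion `R̂`. -/
def completionHomothety (R T : Type*) [CommRing R] [IsLocalRing R] [IsNoetherianRing R]
    [AddCommGroup T] [Module R T] [IsArtinian R T] :
    AdicCompletion (IsLocalRing.maximalIdeal R) R →ₗ[R] (T →ₗ[R] T) :=
  LinearMap.mk₂ R completionSMul
    (fun x y t => by
      obtain ⟨n, hn⟩ := exists_maximalIdeal_pow_le_ker (R := R) t
      obtain ⟨r, hr⟩ := Ideal.Quotient.mk_surjective (AdicCompletion.evalₐ _ n x)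
      obtain ⟨s, hs⟩ := Ideal.Quotient.mk_surjective (AdicCompletion.evalₐ _ n y)
      rw [completionSMul_eq x t n r (fun a ha => hn ha) hr.symm,
        completionSMul_eq y t n s (fun a ha => hn ha) hs.symm,
        completionSMul_eq (x + y) t n (r + s) (fun a ha => hn ha)
          (by rw [map_add, map_add, hr, hs]), add_smul])
    (fun c x t => by
      obtain ⟨n, hn⟩ := exists_maximalIdeal_pow_le_ker (R := R) t
      obtain ⟨r, hr⟩ := Ideal.Quotient.mk_surjective (AdicCompletion.evalₐ _ n x)
      rw [completionSMul_eq x t n r (fun a ha => hn ha) hr.symm,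
        completionSMul_eq (c • x) t n (c * r) (fun a ha => hn ha)
          (by rw [map_smul, map_mul, hr, Algebra.smul_def]; rfl), mul_smul])
    (fun x t u => by
      obtain ⟨k, hk⟩ := exists_maximalIdeal_pow_le_ker (R := R) t
      obtain ⟨l, hl⟩ := exists_maximalIdeal_pow_le_ker (R := R) u
      have hk' : ∀ a ∈ IsLocalRing.maximalIdeal R ^ (max k l), a • t = 0 :=
        fun a ha => hk (Ideal.pow_le_pow_right (le_max_left k l) ha)
      have hl' : ∀ a ∈ IsLocalRing.maximalIdeal R ^ (max k l), a • u = 0 :=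
        fun a ha => hl (Ideal.pow_le_pow_right (le_max_right k l) ha)
      obtain ⟨r, hr⟩ := Ideal.Quotient.mk_surjective (AdicCompletion.evalₐ _ (max k l) x)
      rw [completionSMul_eq x t _ r hk' hr.symm, completionSMul_eq x u _ r hl' hr.symm,
        completionSMul_eq x (t + u) _ r
          (fun a ha => by rw [smul_add, hk' a ha, hl' a ha, add_zero]) hr.symm, smul_add])
    (fun c x t => by
      obtain ⟨n, hn⟩ := exists_maximalIdeal_pow_le_ker (R := R) t
      obtain ⟨r, hr⟩ := Ideal.Quotient.mk_surjective (AdicCompletion.evalₐ _ n x)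
      have hn' : ∀ a ∈ IsLocalRing.maximalIdeal R ^ n, a • t = 0 := fun a ha => hn ha
      rw [completionSMul_eq x t n r hn' hr.symm,
        completionSMul_eq x (c • t) n r
          (fun a ha => by rw [smul_comm, hn' a ha, smul_zero]) hr.symm, smul_comm])

/-- A module `T` over a noetherian local ring `R` is quasidualizing if it is artinian, the homothety
map `R̂ → Hom_R(T, T)` is an isomorphism, and `Ext^i_R(T, T) = 0` for all `i ≥ 1`. -/
structure IsQuasidualizing (R : Type u) [CommRing R] [IsLocalRing R] [IsNoetherianRing R]
    (T : Type u) [AddCommGroup T] [Module R T] : Prop where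
  isArtinian : IsArtinian R T
  homothety_bijective : Function.Bijective (completionHomothety R T)
  ext_subsingleton : ∀ i : ℕ, 1 ≤ i →
    Subsingleton (CategoryTheory.Abelian.Ext (ModuleCat.of R T) (ModuleCat.of R T) i)

end

/-! ### Finite self-injective dimension and associated primes -/

open CategoryTheory Abelian IsLocalRing

/-! The vanishing is torsion against divisibility. If `q` contains a nonzerodivisor `x`, then each
element of E(R/q) is killed by a power of `x`, while the injective module E(k) is `x`-divisible;
hence y ⊗ xⁿg = xⁿy ⊗ g = 0.

Such an `x` exists when `q` has positive height because the associated primes of `R` have height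
zero (`height_eq_zero_of_mem_associatedPrimes`), so prime avoidance applies. Localizing at an
associated prime reduces this to showing that depth zero and finite injective dimension force
dimension zero (`eq_maximalIdeal_of_injectiveDimension_lt_top`). An embedding of `k` in `R` lets the
vanishing of Ext(-, R) on finite modules descend to degree 1; a Nakayama argument then gives
Hom(R/Q, R) = 0 for each nonmaximal prime `Q`, which is impossible for a minimal, hence associated,
prime.

For the counterexample take T = L = E(k) and q = 𝔪. By Matlis theory over a complete ring, E(k) is
artinian with endomorphism ring `R`, so it is quasidualizing. -/

theorem subsingleton_ext_quotient_prime_of_forall_subsingleton_ext_succ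
    {R : Type u} [CommRing R] [IsLocalRing R] [IsNoetherianRing R]
    (M : ModuleCat.{u} R) [Module.Finite R M] (i : ℕ)
    (h : ∀ (N : ModuleCat.{u} R) [Module.Finite R N], Subsingleton (Ext N M (i + 1)))
    (P : Ideal R) [P.IsPrime] (hP : P ≠ maximalIdeal R) :
    Subsingleton (Ext (ModuleCat.of R (R ⧸ P)) M i) := by
  have hle : P ≤ maximalIdeal R := le_maximalIdeal Ideal.IsPrime.ne_top'
  obtain ⟨x, hxm, hxP⟩ := SetLike.exists_of_lt (lt_of_le_of_ne hle hP)
  let T := ModuleCat.of R (R ⧸ P)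
  have reg : IsSMulRegular T x := by
    rw [isSMulRegular_iff_right_eq_zero_of_smul]
    intro a ha
    obtain ⟨a, rfl⟩ := Ideal.Quotient.mk_surjective a
    have h1 : Ideal.Quotient.mk P (x * a) = 0 := by
      rw [map_mul]; exact ha
    rw [Ideal.Quotient.eq_zero_iff_mem] at h1 ⊢
    exact (Ideal.IsPrime.mem_or_mem ‹_› h1).resolve_left hxP
  have hS := reg.smulShortComplex_shortExact
  have : Module.Finite R (T.smulShortComplex x).X₃ :=
    inferInstanceAs (Module.Finite R (QuotSMulTop x (R ⧸ P)))
  -- In the long exact sequence of T → T → T/xT, the obstruction to dividing by `x` lies in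
  -- Ext^(i+1)(T/xT, M) = 0. Nakayama then kills the finite module Ext^i(T, M).
  have hdiv : ∀ e : Ext T M i, ∃ e' : Ext T M i, x • e' = e := by
    intro e
    obtain ⟨e', he'⟩ := Ext.contravariant_sequence_exact₁ hS M e (n₁ := i + 1) (add_comm 1 i)
      ((h (T.smulShortComplex x).X₃).elim _ _)
    have hcomp (y : Ext T M i) : (Ext.mk₀ (x • 𝟙 T)).comp y (zero_add i) = x • y := by
      rw [Ext.mk₀_smul, Ext.smul_comp, Ext.mk₀_id_comp]
    refine ⟨e', (hcomp e').symm.trans ?_⟩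
    rw [← he', ModuleCat.smulShortComplex_f_eq_smul_id]
    rfl
  rw [← Submodule.subsingleton_iff R, ← subsingleton_iff_bot_eq_top, eq_comm]
  refine Submodule.eq_bot_of_le_smul_of_le_jacobson_bot (maximalIdeal R) _ ?_ ?_ ?_
  · exact Module.Finite.fg_top
  · intro e _
    obtain ⟨e', rfl⟩ := hdiv e
    exact Submodule.smul_mem_smul hxm trivial
  · exact maximalIdeal_le_jacobson ⊥

theorem subsingleton_ext_of_injective_of_projective {R : Type u} [CommRing R]
    {K F : Type u} [AddCommGroup K] [Module R K] [AddCommGroup F] [Module R F]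
    [Module.Projective R F] (M : ModuleCat.{u} R) (f : K →ₗ[R] F) (hf : Function.Injective f)
    (i : ℕ) (h : Subsingleton (Ext (ModuleCat.of R (F ⧸ LinearMap.range f)) M (i + 2))) :
    Subsingleton (Ext (ModuleCat.of R K) M (i + 1)) := by
  let S : ShortComplex (ModuleCat.{u} R) :=
    ModuleCat.shortComplexOfCompEqZero _ _ f.exact_map_mkQ_range.linearMap_comp_eq_zero
  have hS : S.ShortExact := ModuleCat.shortComplex_shortExact S
    f.exact_map_mkQ_range hf (Submodule.mkQ_surjective _)
  have : Projective S.X₂ := by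
    rw [← IsProjective.iff_projective]
    assumption
  refine subsingleton_of_forall_eq 0 fun (e : Ext S.X₁ M (i + 1)) => ?_
  obtain ⟨e', rfl⟩ := Ext.contravariant_sequence_exact₁ hS M e (n₁ := i + 2) (add_comm 1 (i + 1))
    (h.elim _ _)
  rw [Ext.eq_zero_of_projective e', Ext.comp_zero]

/-- A prime filtration reduces to N = R/p. Nonmaximal `p` is the Nakayama argument; for p = 𝔪, the
embedding of `k` in the projective module `R` shifts the degree to the cokernel. -/
theorem forall_subsingleton_ext_of_succ
    {R : Type u} [CommRing R] [IsLocalRing R] [IsNoetherianRing R]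
    (f : R ⧸ maximalIdeal R →ₗ[R] R) (hf : Function.Injective f) (i : ℕ)
    (h : ∀ (N : ModuleCat.{u} R) [Module.Finite R N],
      Subsingleton (Ext N (ModuleCat.of R R) (i + 2)))
    (N : Type u) [AddCommGroup N] [Module R N] [hN : Module.Finite R N] :
    Subsingleton (Ext (ModuleCat.of R N) (ModuleCat.of R R) (i + 1)) := by
  have : Module.Finite R (ModuleCat.of R R) := inferInstanceAs (Module.Finite R R)
  induction hN using IsNoetherianRing.induction_on_isQuotientEquivQuotientPrime R with
  | subsingleton N =>
    exact ⟨fun a b => (Ext.eq_zero_of_projective a).trans (Ext.eq_zero_of_projective b).symm⟩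
  | quotient N p e =>
    have key : Subsingleton
        (Ext (ModuleCat.of R (R ⧸ p.asIdeal)) (ModuleCat.of R R) (i + 1)) := by
      by_cases hp : p.asIdeal = maximalIdeal R
      · rw [hp]
        have : Module.Finite R (ModuleCat.of R (R ⧸ LinearMap.range f)) :=
          inferInstanceAs (Module.Finite R (R ⧸ LinearMap.range f))
        exact subsingleton_ext_of_injective_of_projective _ f hf i (h _)
      · exact subsingleton_ext_quotient_prime_of_forall_subsingleton_ext_succ _ _ h _ hp
    refine subsingleton_of_forall_eq 0 fun x => ?_
    have h1 : (Ext.mk₀ e.toModuleIso.inv).comp x (zero_add _) = 0 := key.elim _ _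
    have h2 : (Ext.mk₀ e.toModuleIso.hom).comp
        ((Ext.mk₀ e.toModuleIso.inv).comp x (zero_add _)) (zero_add _) = x := by
      rw [Ext.mk₀_comp_mk₀_assoc, Iso.hom_inv_id, Ext.mk₀_id_comp]
    rw [← h2, h1, Ext.comp_zero]
  | exact N₁ N₂ N₃ f g hf hg hfg h₁ h₃ =>
    let S : ShortComplex (ModuleCat.{u} R) :=
      ModuleCat.shortComplexOfCompEqZero _ _ hfg.linearMap_comp_eq_zero
    have hS : S.ShortExact := ModuleCat.shortComplex_shortExact S hfg hf hg
    refine subsingleton_of_forall_eq 0 fun (e : Ext S.X₂ (ModuleCat.of R R) (i + 1)) => ?_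
    obtain ⟨e', rfl⟩ := Ext.contravariant_sequence_exact₂ hS _ e (h₁.elim _ _)
    rw [show e' = 0 from h₃.elim _ _, Ext.comp_zero]

/-- A noetherian local ring of depth zero and of finite injective dimension over itself has no
prime ideal besides the maximal one. -/
theorem eq_maximalIdeal_of_injectiveDimension_lt_top
    {R : Type u} [CommRing R] [IsLocalRing R] [IsNoetherianRing R]
    (hR : injectiveDimension (ModuleCat.of R R) < ⊤)
    (hass : maximalIdeal R ∈ associatedPrimes R R) (P : Ideal R) [P.IsPrime] :
    P = maximalIdeal R := by
  have hfin : Module.Finite R (ModuleCat.of R R) := inferInstanceAs (Module.Finite R R)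
  obtain ⟨-, f, hf⟩ := (isAssociatedPrime_iff_exists_injective_linearMap _ _).mp hass
  obtain ⟨n, hn⟩ := (injectiveDimension_ne_top_iff _).mp hR.ne
  have hone : ∀ (N : ModuleCat.{u} R) [Module.Finite R N],
      Subsingleton (Ext N (ModuleCat.of R R) 1) := by
    have : ∀ j ≤ n, ∀ (N : ModuleCat.{u} R) [Module.Finite R N],
        Subsingleton (Ext N (ModuleCat.of R R) (j + 1)) := by
      intro j hj
      induction hj using Nat.decreasingInduction with
      | of_succ j hj ih => exact fun N _ => forall_subsingleton_ext_of_succ f hf j ih N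
      | self => exact fun N _ => HasInjectiveDimensionLT.subsingleton _ (n + 1) _ le_rfl _
    exact this 0 n.zero_le
  obtain ⟨Q, hQ, hQP⟩ := Ideal.exists_minimalPrimes_le (bot_le : ⊥ ≤ P)
  have : Q.IsPrime := hQ.isPrime
  suffices Q = maximalIdeal R from le_antisymm (le_maximalIdeal Ideal.IsPrime.ne_top') (this ▸ hQP)
  by_contra hne
  have hQass : Q ∈ associatedPrimes R R := by
    apply Module.associatedPrimes.minimalPrimes_annihilator_subset_associatedPrimes
    rwa [(Module.annihilator_eq_bot).mpr inferInstance]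
  obtain ⟨-, g, hg⟩ := (isAssociatedPrime_iff_exists_injective_linearMap _ _).mp hQass
  -- Degree 0: Hom(R/Q, R) vanishes, against the embedding `g`.
  have hsub := subsingleton_ext_quotient_prime_of_forall_subsingleton_ext_succ
    (ModuleCat.of R R) 0 hone Q hne
  have hg0 : Ext.mk₀ (ModuleCat.ofHom g) = 0 := hsub.elim _ _
  rw [Ext.mk₀_eq_zero_iff] at hg0
  have : g = 0 := by simpa using congr(($hg0).hom)
  have := hg.ne (show (1 : R ⧸ Q) ≠ 0 from one_ne_zero)
  simp_all

theorem injectiveDimension_localization_lt_top {R : Type u} [CommRing R] [IsNoetherianRing R]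
    (hR : injectiveDimension (ModuleCat.of R R) < ⊤) (S : Submonoid R) :
    injectiveDimension (ModuleCat.of (Localization S) (Localization S)) < ⊤ := by
  have (M : ModuleCat.{u} R) (e : M ≃ₗ[R] R) :
      Nonempty (Localization S ≃ₗ[R] M.localizedModule S) :=
    have := IsLocalizedModule.of_linearEquiv_right S (Algebra.linearMap R (Localization S)) e
    ⟨IsLocalizedModule.linearEquiv S (Algebra.linearMap R (Localization S) ∘ₗ e.toLinearMap)
      (M.localizedModuleMkLinearMap S)⟩
  obtain ⟨e⟩ := this (ModuleCat.of R R) (LinearEquiv.refl R R)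
  refine lt_of_eq_of_lt ?_ ((ModuleCat.injectiveDimension_le_injectiveDimension_of_isLocalizedModule
    S (ModuleCat.of R R)).trans_lt hR)
  exact ModuleCat.injectiveDimension_eq_of_linearEquiv
    (LinearEquiv.extendScalarsOfIsLocalization S (Localization S) e)

/-- Over a noetherian ring of finite injective dimension over itself, the associated primes are
minimal. -/
theorem height_eq_zero_of_mem_associatedPrimes {R : Type u} [CommRing R] [IsNoetherianRing R]
    (hR : injectiveDimension (ModuleCat.of R R) < ⊤) {p : Ideal R}
    (hp : p ∈ associatedPrimes R R) : p.height = 0 := by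
  have : p.IsPrime := hp.isPrime
  have hass : maximalIdeal (Localization.AtPrime p) ∈
      associatedPrimes (Localization.AtPrime p) (Localization.AtPrime p) := by
    apply Module.associatedPrimes.mem_associatedPrimes_of_comap_mem_associatedPrimes_of_isLocalizedModule
      p.primeCompl (Algebra.linearMap R (Localization.AtPrime p))
    simpa [Localization.AtPrime.under_maximalIdeal] using hp
  have hdim : Ring.KrullDimLE 0 (Localization.AtPrime p) := by
    rw [Ring.krullDimLE_zero_iff]
    intro I hI
    rw [eq_maximalIdeal_of_injectiveDimension_lt_top
      (injectiveDimension_localization_lt_top hR p.primeCompl) hass I]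
    infer_instance
  have h := IsLocalization.AtPrime.ringKrullDim_eq_height p (Localization.AtPrime p)
  rw [ringKrullDimZero_iff_ringKrullDim_eq_zero.mp hdim] at h
  exact_mod_cast h.symm

theorem exists_mem_nonZeroDivisors_of_height_pos {R : Type u} [CommRing R] [IsNoetherianRing R]
    (hR : injectiveDimension (ModuleCat.of R R) < ⊤) {q : Ideal R} (hq : 0 < q.height) :
    ∃ x ∈ q, x ∈ nonZeroDivisors R := by
  by_contra! h
  have hsub : (q : Set R) ⊆ ⋃ p ∈ associatedPrimes R R, (p : Set R) := by
    rw [biUnion_associatedPrimes_eq_compl_nonZeroDivisors]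
    exact fun x hx => h x hx
  -- The two `0`s are the indices that prime avoidance exempts from primality; no exemption is
  -- needed here.
  obtain ⟨p, hp, hqp⟩ := (q.subset_union_prime_finite (associatedPrimes.finite R R) (f := id) 0 0
    fun _ h _ _ => h.isPrime).1 hsub
  exact hq.not_ge ((Ideal.height_mono hqp).trans
    (height_eq_zero_of_mem_associatedPrimes hR hp).le)

/-! ### Torsion, divisibility and the vanishing of the tensor product -/

section

variable {R : Type u} [CommRing R]

/-- Extend 1 ↦ f along the injection R → R given by multiplication by `x`. -/
theorem Module.Injective.exists_smul_eq {F : Type u} [AddCommGroup F] [Module R F]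
    (hF : Module.Injective R F) {x : R} (hx : x ∈ nonZeroDivisors R) (f : F) :
    ∃ g : F, x • g = f := by
  obtain ⟨h, hh⟩ := hF.out (LinearMap.mulLeft R x)
    (fun a b hab => (mul_cancel_left_mem_nonZeroDivisors hx).mp hab)
    (LinearMap.toSpanSingleton R F f)
  refine ⟨h 1, ?_⟩
  rw [← map_smul]
  simpa using hh 1

/-- Every element of the injective hull of `R ⧸ q`, with `q` prime, is annihilated by a power
of `q`. -/
theorem IsInjectiveHull.exists_pow_smul_eq_zero [IsNoetherianRing R] {q : Ideal R} [q.IsPrime]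
    {M E : Type u} [AddCommGroup M] [Module R M] [AddCommGroup E] [Module R E]
    {ι : M →ₗ[R] E} (hι : IsInjectiveHull ι) (e : (R ⧸ q) ≃ₗ[R] M) (y : E) :
    ∃ n : ℕ, ∀ a ∈ q ^ n, a • y = 0 := by
  let I : Ideal R := LinearMap.ker (LinearMap.toSpanSingleton R E y)
  suffices q ≤ I.radical by
    obtain ⟨n, hn⟩ := Ideal.exists_pow_le_of_le_radical_of_fg this (IsNoetherian.noetherian q)
    exact ⟨n, fun a ha => hn ha⟩
  rw [← Ideal.sInf_minimalPrimes]
  refine le_sInf fun p hp => ?_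
  have hpI : p ∈ associatedPrimes R (R ⧸ I) := by
    apply Module.associatedPrimes.minimalPrimes_annihilator_subset_associatedPrimes
    rwa [Ideal.annihilator_quotient]
  have hpE : IsAssociatedPrime p E := IsAssociatedPrime.map_of_injective
    (I.liftQ (LinearMap.toSpanSingleton R E y) le_rfl) hpI
    (LinearMap.ker_eq_bot.mp (Submodule.ker_liftQ_eq_bot' _ _ rfl))
  obtain ⟨hprime, f, hf⟩ := (isAssociatedPrime_iff_exists_injective_linearMap _ _).mp hpE
  -- By essentiality the copies of R/p and R/q in `E` share a nonzero element. It is killed by `q`,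
  -- and its annihilator is `p`, so q ≤ p.
  have hne : LinearMap.range f ⊓ LinearMap.range ι ≠ ⊥ := by
    intro h
    have h0 := hι.essential _ h
    rw [LinearMap.range_eq_bot] at h0
    have := hf.ne (show (1 : R ⧸ p) ≠ 0 from one_ne_zero)
    simp_all
  obtain ⟨z, ⟨⟨a, rfl⟩, m, hm⟩, hz⟩ := Submodule.exists_mem_ne_zero_of_ne_bot hne
  intro r hr
  obtain ⟨b, rfl⟩ := e.surjective m
  obtain ⟨a, rfl⟩ := Ideal.Quotient.mk_surjective a
  obtain ⟨b, rfl⟩ := Ideal.Quotient.mk_surjective b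
  have hrb : r • Ideal.Quotient.mk q b = 0 := by
    change Ideal.Quotient.mk q (r * b) = 0
    exact Ideal.Quotient.eq_zero_iff_mem.mpr (q.mul_mem_right b hr)
  have hra : r • Ideal.Quotient.mk p a = 0 := by
    apply hf
    rw [map_smul, ← hm, ← map_smul, ← map_smul, hrb, map_zero, map_zero, map_zero]
  have ha : a ∉ p := by
    intro ha
    rw [Ideal.Quotient.eq_zero_iff_mem.mpr ha, map_zero] at hz
    exact hz rfl
  have hra' : r * a ∈ p := Ideal.Quotient.eq_zero_iff_mem.mp hra
  exact (hprime.mem_or_mem hra').resolve_right ha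

theorem subsingleton_tensorProduct_of_torsion_of_divisible
    {E F : Type*} [AddCommGroup E] [Module R E] [AddCommGroup F] [Module R F] (x : R)
    (hE : ∀ y : E, ∃ n : ℕ, x ^ n • y = 0) (hF : ∀ f : F, ∃ g : F, x • g = f) :
    Subsingleton (E ⊗[R] F) := by
  have hpow (n : ℕ) : ∀ f : F, ∃ g : F, x ^ n • g = f := by
    induction n with
    | zero => exact fun f => ⟨f, by simp⟩
    | succ n ih =>
      intro f
      obtain ⟨g, rfl⟩ := hF f
      obtain ⟨g, rfl⟩ := ih g
      exact ⟨g, by rw [pow_succ', mul_smul]⟩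
  refine subsingleton_of_forall_eq 0 fun t => ?_
  induction t with
  | zero => rfl
  | add a b ha hb => rw [ha, hb, add_zero]
  | tmul y f =>
    obtain ⟨n, hn⟩ := hE y
    obtain ⟨g, rfl⟩ := hpow n f
    rw [← TensorProduct.smul_tmul, hn, TensorProduct.zero_tmul]

theorem IsInjectiveHull.subsingleton_tensorProduct [IsNoetherianRing R]
    (hR : injectiveDimension (ModuleCat.of R R) < ⊤) {q : Ideal R} [q.IsPrime]
    (hq : 0 < q.height)
    {M E F : Type u} [AddCommGroup M] [Module R M] [AddCommGroup E] [Module R E]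
    [AddCommGroup F] [Module R F] {ι : M →ₗ[R] E} (hι : IsInjectiveHull ι)
    (e : (R ⧸ q) ≃ₗ[R] M) (hF : Module.Injective R F) : Subsingleton (E ⊗[R] F) := by
  obtain ⟨x, hxq, hx⟩ := exists_mem_nonZeroDivisors_of_height_pos hR hq
  refine subsingleton_tensorProduct_of_torsion_of_divisible x (fun y => ?_)
    (hF.exists_smul_eq hx)
  obtain ⟨n, hn⟩ := hι.exists_pow_smul_eq_zero e y
  exact ⟨n, hn _ (Ideal.pow_mem_pow hxq n)⟩

end

/-! ### Existence of injective hulls -/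

section

variable {R : Type u} [CommRing R]

theorem Submodule.exists_maximal_essential {I : Type*} [AddCommGroup I] [Module R I]
    (K : Submodule R I) :
    ∃ E : Submodule R I, Maximal
      (fun E => K ≤ E ∧ ∀ x ∈ E, x ≠ 0 → ∃ r : R, r • x ∈ K ∧ r • x ≠ 0) E := by
  let s : Set (Submodule R I) := {E | K ≤ E ∧ ∀ x ∈ E, x ≠ 0 → ∃ r : R, r • x ∈ K ∧ r • x ≠ 0}
  obtain ⟨E, -, hE⟩ := zorn_le_nonempty₀ s (fun c hcs hc E₀ hE₀ => by
    refine ⟨sSup c, ⟨(hcs hE₀).1.trans (le_sSup hE₀), fun x hx hx0 => ?_⟩,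
      fun _ h => le_sSup h⟩
    obtain ⟨E, hEc, hxE⟩ := (Submodule.mem_sSup_of_directed ⟨E₀, hE₀⟩ hc.directedOn).mp hx
    exact (hcs hEc).2 x hxE hx0) K ⟨le_rfl, fun x hx hx0 => ⟨1, by simpa using ⟨hx, hx0⟩⟩⟩
  exact ⟨E, hE⟩

theorem Submodule.exists_maximal_disjoint {I : Type*} [AddCommGroup I] [Module R I]
    (E : Submodule R I) : ∃ C : Submodule R I, Maximal (fun C => Disjoint C E) C := by
  obtain ⟨C, -, hC⟩ := zorn_le_nonempty₀ {C : Submodule R I | Disjoint C E}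
    (fun c hcs hc C₀ hC₀ => by
      refine ⟨sSup c, ?_, fun _ h => le_sSup h⟩
      refine Submodule.disjoint_def.mpr fun x hx hxE => ?_
      obtain ⟨C, hCc, hxC⟩ := (Submodule.mem_sSup_of_directed ⟨C₀, hC₀⟩ hc.directedOn).mp hx
      exact Submodule.disjoint_def.mp (hcs hCc) x hxC hxE) ⊥ disjoint_bot_left
  exact ⟨C, hC⟩

/-- In an injective module, a maximal essential extension of a submodule is a direct summand. -/
theorem Submodule.exists_isCompl_of_maximal_essential {I : Type u} [AddCommGroup I] [Module R I]
    (hI : Module.Injective R I) {K E : Submodule R I} (hE : Maximal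
      (fun E => K ≤ E ∧ ∀ x ∈ E, x ≠ 0 → ∃ r : R, r • x ∈ K ∧ r • x ≠ 0) E) :
    ∃ C : Submodule R I, IsCompl C E := by
  obtain ⟨C, hC⟩ := E.exists_maximal_disjoint
  refine ⟨C, hC.prop, codisjoint_iff.mpr ?_⟩
  have hinj : Function.Injective (C.mkQ ∘ₗ E.subtype) := by
    rw [injective_iff_map_eq_zero]
    rintro ⟨x, hx⟩ h
    have hxC : x ∈ C := by simpa using h
    exact Subtype.ext (Submodule.disjoint_def.mp hC.prop x hxC hx)
  obtain ⟨h, hh⟩ := hI.out (C.mkQ ∘ₗ E.subtype) hinj E.subtype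
  have hh' (x : I) (hx : x ∈ E) : h (C.mkQ x) = x := hh ⟨x, hx⟩
  -- Since `h` is the identity on `E`, adjoining `x` to `C` keeps it disjoint from `E`; maximality
  -- of `C` applies.
  have hker (x : I) (hx : h (C.mkQ x) = 0) : x ∈ C := by
    have hdis : Disjoint (C ⊔ span R {x}) E := by
      refine Submodule.disjoint_def.mpr fun y hy hyE => ?_
      obtain ⟨c, hc, z, hz, rfl⟩ := Submodule.mem_sup.mp hy
      obtain ⟨r, rfl⟩ := Submodule.mem_span_singleton.mp hz
      rw [← hh' _ hyE, map_add, map_add, map_smul, map_smul, hx, smul_zero, add_zero,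
        show C.mkQ c = 0 by simpa using hc, map_zero]
    exact hC.le_of_ge hdis le_sup_left
      (Submodule.mem_sup_right (Submodule.mem_span_singleton_self x))
  -- Maximality of `C` makes the image of `E` essential in I/C. Hence the range of `h` is still
  -- essential over `K`, and maximality of `E` bounds it; `h` thus gives a projection onto `E`.
  have hess : ∀ x : I, h (C.mkQ x) ≠ 0 → ∃ r : R, r • x ∉ C ∧ ∃ y ∈ E, r • x - y ∈ C := by
    intro x hx
    by_contra! hcon
    have hdis : Disjoint (C ⊔ span R {x}) E := by
      refine Submodule.disjoint_def.mpr fun y hy hyE => ?_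
      obtain ⟨c, hc, z, hz, rfl⟩ := Submodule.mem_sup.mp hy
      obtain ⟨r, rfl⟩ := Submodule.mem_span_singleton.mp hz
      by_cases hr : r • x ∈ C
      · exact Submodule.disjoint_def.mp hC.prop _ (C.add_mem hc hr) hyE
      · refine absurd ?_ (hcon r hr _ hyE)
        rw [sub_add_cancel_right]
        exact C.neg_mem hc
    have hxC : x ∈ C := hC.le_of_ge hdis le_sup_left
      (Submodule.mem_sup_right (Submodule.mem_span_singleton_self x))
    apply hx
    rw [show C.mkQ x = 0 by simpa using hxC, map_zero]
  have hrange : LinearMap.range h ≤ E := by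
    refine hE.le_of_ge ⟨fun x hx => ⟨C.mkQ x, hh' x (hE.prop.1 hx)⟩, ?_⟩
      fun x hx => ⟨C.mkQ x, hh' x hx⟩
    rintro _ ⟨z, rfl⟩ hz
    obtain ⟨x, rfl⟩ := C.mkQ_surjective z
    obtain ⟨r, hr, y, hy, hry⟩ := hess x hz
    have hxy : r • h (C.mkQ x) = y := by
      have : C.mkQ (r • x - y) = 0 := (Quotient.mk_eq_zero C).mpr hry
      rw [map_sub, sub_eq_zero, map_smul] at this
      rw [← map_smul, this, hh' y hy]
    have hy0 : y ≠ 0 := by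
      rintro rfl
      exact hr (by simpa using hry)
    obtain ⟨t, ht, ht0⟩ := hE.prop.2 y hy hy0
    exact ⟨t * r, by rwa [mul_smul, hxy], by rwa [mul_smul, hxy]⟩
  refine eq_top_iff'.mpr fun x => ?_
  have hy : h (C.mkQ x) ∈ E := hrange ⟨_, rfl⟩
  rw [← sub_add_cancel x (h (C.mkQ x))]
  refine Submodule.add_mem_sup (hker _ ?_) hy
  rw [map_sub, map_sub, hh' _ hy, sub_self]

theorem Module.Injective.of_isCompl {I : Type u} [AddCommGroup I] [Module R I]
    (hI : Module.Injective R I) {C E : Submodule R I} (h : IsCompl C E) :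
    Module.Injective R E where
  out X Y _ _ _ _ f hf g := by
    obtain ⟨k, hk⟩ := hI.out f hf (E.subtype ∘ₗ g)
    refine ⟨Submodule.projectionOnto E C h.symm ∘ₗ k, fun x => ?_⟩
    rw [LinearMap.comp_apply, hk]
    exact Submodule.projectionOnto_apply_left h.symm (g x)

theorem exists_isInjectiveHull (M : Type u) [AddCommGroup M] [Module R M] :
    ∃ (E : Type u) (_ : AddCommGroup E) (_ : Module R E) (ι : M →ₗ[R] E), IsInjectiveHull ι := by
  let ⟨I, _, f, _⟩ := EnoughInjectives.presentation (ModuleCat.of R M)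
  have hI : Module.Injective R I := Module.injective_module_of_injective_object R I
  have hf : Function.Injective f.hom := (ModuleCat.mono_iff_injective f).mp ‹_›
  obtain ⟨E, hE⟩ := (LinearMap.range f.hom).exists_maximal_essential
  obtain ⟨C, hC⟩ := Submodule.exists_isCompl_of_maximal_essential hI hE
  let ι : M →ₗ[R] E := f.hom.codRestrict E fun x => hE.prop.1 ⟨x, rfl⟩
  refine ⟨E, inferInstance, inferInstance, ι, hI.of_isCompl hC,
    fun x y hxy => hf congr(($hxy).1), fun N hN => ?_⟩
  refine (Submodule.eq_bot_iff N).mpr fun x hx => ?_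
  by_contra hx0
  obtain ⟨r, ⟨m, hm⟩, hr0⟩ := hE.prop.2 x x.2 (by simpa using hx0)
  have hmem : r • x ∈ N ⊓ LinearMap.range ι := ⟨N.smul_mem r hx, m, Subtype.ext hm⟩
  rw [hN, Submodule.mem_bot] at hmem
  exact hr0 congr(($hmem).1)

end

/-! ### Matlis theory for the injective hull of the residue field -/

namespace IsInjectiveHull

variable {R : Type u} [CommRing R] [IsLocalRing R] {E : Type u} [AddCommGroup E] [Module R E]
  {ι : ResidueField R →ₗ[R] E}

theorem smul_apply_one_eq_zero (ι : ResidueField R →ₗ[R] E) {a : R} (ha : a ∈ maximalIdeal R) :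
    a • ι 1 = 0 := by
  rw [← map_smul, Algebra.smul_def, mul_one, ResidueField.algebraMap_eq,
    (residue_eq_zero_iff a).mpr ha, map_zero]

theorem apply_one_ne_zero (hι : IsInjectiveHull ι) : ι 1 ≠ 0 := fun h =>
  one_ne_zero (hι.injective (h.trans (map_zero ι).symm))

/-- The socle of the injective hull of the residue field is generated by the image of `1`. -/
theorem exists_smul_apply_one_eq (hι : IsInjectiveHull ι) {y : E}
    (hy : ∀ a ∈ maximalIdeal R, a • y = 0) : ∃ c : R, c • ι 1 = y := by
  obtain rfl | hy0 := eq_or_ne y 0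
  · exact ⟨0, zero_smul R _⟩
  have hne : Submodule.span R {y} ⊓ LinearMap.range ι ≠ ⊥ := fun h =>
    hy0 (Submodule.span_singleton_eq_bot.mp (hι.essential _ h))
  obtain ⟨z, ⟨hzy, b, rfl⟩, hz0⟩ := Submodule.exists_mem_ne_zero_of_ne_bot hne
  obtain ⟨r, hr⟩ := Submodule.mem_span_singleton.mp hzy
  have hru : IsUnit r := by
    by_contra h
    exact hz0 (hr.symm.trans (hy r ((mem_maximalIdeal r).mpr h)))
  obtain ⟨u, rfl⟩ := hru
  obtain ⟨b, rfl⟩ := residue_surjective b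
  refine ⟨(↑u⁻¹ : R) * b, ?_⟩
  rw [mul_smul, ← map_smul, Algebra.smul_def, mul_one, ResidueField.algebraMap_eq, ← hr, smul_smul,
    Units.inv_mul, one_smul]

/-- The injective hull of the residue field is a cogenerator. -/
theorem exists_linearMap_apply_ne_zero (hι : IsInjectiveHull ι) {X : Type u} [AddCommGroup X]
    [Module R X] {x : X} (hx : x ≠ 0) : ∃ φ : X →ₗ[R] E, φ x ≠ 0 := by
  let I : Ideal R := LinearMap.ker (LinearMap.toSpanSingleton R X x)
  -- As the annihilator of `x` lies in 𝔪, the map Rx → E sending `x` to `ι 1` is well defined;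
  -- injectivity extends it to `X`.
  have hI : I ≤ maximalIdeal R := le_maximalIdeal fun h => hx (by
    have h1 : (1 : R) ∈ I := h ▸ Submodule.mem_top
    simpa [I] using h1)
  have hle : I ≤ LinearMap.ker (LinearMap.toSpanSingleton R E (ι 1)) :=
    fun a ha => smul_apply_one_eq_zero ι (hI ha)
  obtain ⟨φ, hφ⟩ := hι.module_injective.out
    (I.liftQ (LinearMap.toSpanSingleton R X x) le_rfl)
    (LinearMap.ker_eq_bot.mp (Submodule.ker_liftQ_eq_bot' _ _ rfl))
    (I.liftQ (LinearMap.toSpanSingleton R E (ι 1)) hle)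
  refine ⟨φ, ?_⟩
  have h1 := hφ (I.mkQ 1)
  rw [Submodule.mkQ_apply, Submodule.liftQ_apply, Submodule.liftQ_apply,
    LinearMap.toSpanSingleton_apply_one, LinearMap.toSpanSingleton_apply_one] at h1
  rw [h1]
  exact hι.apply_one_ne_zero

theorem exists_smul_ne_zero (hι : IsInjectiveHull ι) {I : Ideal R} {r : R} (hr : r ∉ I) :
    ∃ y : E, (∀ a ∈ I, a • y = 0) ∧ r • y ≠ 0 := by
  obtain ⟨φ, hφ⟩ := hι.exists_linearMap_apply_ne_zero (X := R ⧸ I)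
    (x := Ideal.Quotient.mk I r) (by rwa [Ne, Ideal.Quotient.eq_zero_iff_mem])
  have h (a : R) : a • φ 1 = φ (Ideal.Quotient.mk I a) := by
    rw [← map_smul, Algebra.smul_def, mul_one]; rfl
  refine ⟨φ 1, fun a ha => ?_, by rwa [h]⟩
  rw [h, Ideal.Quotient.eq_zero_iff_mem.mpr ha, map_zero]

variable [IsNoetherianRing R]

theorem exists_maximalIdeal_pow_smul_eq_zero (hι : IsInjectiveHull ι) (y : E) :
    ∃ n : ℕ, ∀ a ∈ maximalIdeal R ^ n, a • y = 0 :=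
  hι.exists_pow_smul_eq_zero (q := maximalIdeal R) (LinearEquiv.refl R (ResidueField R)) y

/-- An endomorphism of the injective hull of the residue field acts on the elements annihilated
by an `𝔪`-primary ideal as a scalar does. -/
theorem exists_smul_eq_of_pow_le (hι : IsInjectiveHull ι) (φ : E →ₗ[R] E) (n : ℕ) (I : Ideal R)
    (hI : maximalIdeal R ^ n ≤ I) : ∃ r : R, ∀ y : E, (∀ a ∈ I, a • y = 0) → φ y = r • y := by
  induction I using WellFoundedGT.induction with
  | ind I ih =>
    by_cases htop : I = ⊤
    · refine ⟨0, fun y hy => ?_⟩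
      have : y = 0 := by simpa using hy 1 (htop ▸ Submodule.mem_top)
      simp [this]
    -- A socle element of R/I, taken from the last power of 𝔪 not contained in `I`.
    obtain ⟨x, hxI, hx⟩ : ∃ x ∉ I, ∀ a ∈ maximalIdeal R, a * x ∈ I := by
      classical
      have hex : ∃ k, maximalIdeal R ^ k ≤ I := ⟨n, hI⟩
      obtain ⟨k, hk⟩ : ∃ k, Nat.find hex = k + 1 := Nat.exists_eq_succ_of_ne_zero fun h0 => by
        have := Nat.find_spec hex
        rw [h0, pow_zero, Ideal.one_eq_top, top_le_iff] at this
        exact htop this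
      obtain ⟨x, hx, hxI⟩ := SetLike.not_le_iff_exists.mp (Nat.find_min hex (m := k) (by omega))
      refine ⟨x, hxI, fun a ha => ?_⟩
      have hspec := Nat.find_spec hex
      rw [hk, pow_succ'] at hspec
      exact hspec (Ideal.mul_mem_mul ha hx)
    have hlt : I < I ⊔ Ideal.span {x} := lt_of_le_of_ne le_sup_left fun h =>
      hxI (h ▸ Ideal.mem_sup_right (Ideal.mem_span_singleton_self x))
    obtain ⟨r, hr⟩ := ih _ hlt (hI.trans hlt.le)
    have hr' (y : E) (hy : ∀ a ∈ I, a • y = 0) (hxy : x • y = 0) : φ y = r • y := by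
      refine hr y fun a ha => ?_
      obtain ⟨b, hb, c, hc, rfl⟩ := Submodule.mem_sup.mp ha
      obtain ⟨c, rfl⟩ := Ideal.mem_span_singleton'.mp hc
      rw [add_smul, hb |> hy b, mul_smul, hxy, smul_zero, add_zero]
    -- On elements killed by `I` and `x` the scalar `r` already works. Multiplication by `x` sends
    -- elements killed by `I` into the one-dimensional socle of `E`, so at most one further element
    -- `y₀` needs correcting.
    obtain hker | ⟨y₀, hy₀, hxy₀⟩ : (∀ y : E, (∀ a ∈ I, a • y = 0) → x • y = 0) ∨
        ∃ y : E, (∀ a ∈ I, a • y = 0) ∧ x • y ≠ 0 := by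
      by_contra! h
      obtain ⟨⟨y, hy, hxy⟩, h⟩ := h
      exact hxy (h y hy)
    · exact ⟨r, fun y hy => hr' y hy (hker y hy)⟩
    have hsoc (y : E) (hy : ∀ a ∈ I, a • y = 0) : ∃ c : R, c • ι 1 = x • y :=
      hι.exists_smul_apply_one_eq fun a ha => by rw [smul_smul, hy _ (hx a ha)]
    obtain ⟨c₀, hc₀⟩ := hsoc y₀ hy₀
    have hc₀u : IsUnit c₀ := by
      by_contra h
      exact hxy₀ (hc₀.symm.trans (smul_apply_one_eq_zero ι ((mem_maximalIdeal c₀).mpr h)))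
    obtain ⟨u, rfl⟩ := hc₀u
    obtain ⟨d, hd⟩ : ∃ d : R, d • ι 1 = φ y₀ - r • y₀ :=
      hι.exists_smul_apply_one_eq fun a ha => by
        rw [smul_sub, ← map_smul, smul_comm a r, sub_eq_zero]
        refine hr' _ (fun b hb => ?_) ?_
        · rw [smul_comm, hy₀ b hb, smul_zero]
        · rw [smul_smul, mul_comm, hy₀ _ (hx a ha)]
    have hone : ι 1 = (↑u⁻¹ : R) • x • y₀ := by
      rw [← hc₀, smul_smul, Units.inv_mul, one_smul]
    -- The correction vanishes where `x` does, and on `y₀` it equals `d • ι 1`, the error of `r`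
    -- there.
    refine ⟨r + d * ↑u⁻¹ * x, fun y hy => ?_⟩
    obtain ⟨c, hc⟩ := hsoc y hy
    have hsub := hr' (y - (c * ↑u⁻¹) • y₀)
      (fun a ha => by rw [smul_sub, hy a ha, smul_comm, hy₀ a ha, smul_zero, sub_zero])
      (by rw [smul_sub, ← hc, hone, smul_smul, smul_smul, smul_smul, ← sub_smul,
        show c * ↑u⁻¹ * x - x * (c * ↑u⁻¹) = 0 by ring, zero_smul])
    rw [map_sub, map_smul, smul_sub, sub_eq_iff_eq_add] at hsub
    have hxy : (d * ↑u⁻¹ * x) • y = (c * ↑u⁻¹) • (φ y₀ - r • y₀) := by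
      rw [mul_smul, ← hc, ← hd, smul_smul, smul_smul]
      congr 1
      ring
    rw [hsub, add_smul, hxy, smul_sub, smul_comm r]
    abel

variable [IsAdicComplete (maximalIdeal R) R]

/-- Over a complete noetherian local ring, the endomorphisms of the injective hull of the residue
field are the scalars. -/
theorem lsmul_bijective (hι : IsInjectiveHull ι) :
    Function.Bijective (LinearMap.lsmul R E) := by
  constructor
  · rw [injective_iff_map_eq_zero]
    intro r hr
    refine IsHausdorff.haus (I := maximalIdeal R) inferInstance r fun n => ?_
    rw [SModEq.zero, smul_eq_mul, Ideal.mul_top]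
    by_contra h
    obtain ⟨y, -, hy⟩ := hι.exists_smul_ne_zero h
    exact hy congr($hr y)
  · intro φ
    -- These scalars are determined modulo 𝔪ⁿ, hence form a Cauchy sequence; its limit acts as `φ`
    -- because every element of `E` is 𝔪-power torsion.
    choose r hr using fun n => hι.exists_smul_eq_of_pow_le φ n (maximalIdeal R ^ n) le_rfl
    have hcauchy {m n : ℕ} (hmn : m ≤ n) : r m - r n ∈ maximalIdeal R ^ m := by
      by_contra h
      obtain ⟨y, hy, hy'⟩ := hι.exists_smul_ne_zero h
      apply hy'
      rw [sub_smul, ← hr m y hy, ← hr n y fun a ha => hy a (Ideal.pow_le_pow_right hmn ha),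
        sub_self]
    obtain ⟨s, hs⟩ := IsPrecomplete.prec (I := maximalIdeal R) (M := R) inferInstance
      (f := r) fun hmn => by
        rw [SModEq.sub_mem, smul_eq_mul, Ideal.mul_top]
        exact hcauchy hmn
    refine ⟨s, LinearMap.ext fun y => ?_⟩
    obtain ⟨n, hn⟩ := hι.exists_maximalIdeal_pow_smul_eq_zero y
    have hsn := hs n
    rw [SModEq.sub_mem, smul_eq_mul, Ideal.mul_top] at hsn
    rw [hr n y hn, LinearMap.lsmul_apply, eq_comm, ← sub_eq_zero, ← sub_smul]
    exact hn _ hsn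

/-- A submodule `N` is recovered from its annihilator: a map E/N → E not killing the class of `y`
is, as an endomorphism of `E`, a scalar that kills `N` but not `y`. So submodules embed, order
reversed, into the ideals of the noetherian ring `R`. -/
theorem isArtinian (hι : IsInjectiveHull ι) : IsArtinian R E := by
  have hmem (N : Submodule R E) (y : E) (hy : ∀ a ∈ Module.annihilator R N, a • y = 0) :
      y ∈ N := by
    by_contra hyN
    obtain ⟨φ, hφ⟩ := hι.exists_linearMap_apply_ne_zero (x := N.mkQ y) (by simpa using hyN)
    obtain ⟨r, hr⟩ := hι.lsmul_bijective.2 (φ ∘ₗ N.mkQ)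
    have hr' (z : E) : r • z = φ (N.mkQ z) := congr($hr z)
    apply hφ
    rw [← hr']
    refine hy r (Module.mem_annihilator.mpr fun z => Subtype.ext ?_)
    rw [Submodule.coe_smul, hr', show N.mkQ z = 0 by simp, map_zero, Submodule.coe_zero]
  let f (N : Submodule R E) : Ideal R := Module.annihilator R N
  have hf : StrictAnti f := by
    refine Antitone.strictAnti_of_injective (fun N N' h a ha => ?_) fun N N' h => ?_
    · exact Module.mem_annihilator.mpr fun z => Subtype.ext
        congr(($(Module.mem_annihilator.mp ha ⟨z, h z.2⟩)).1)
    · refine le_antisymm (fun y hy => hmem N' y fun a ha => ?_) fun y hy => hmem N y fun a ha => ?_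
      · have ha' : a ∈ f N := h ▸ ha
        exact congr(($(Module.mem_annihilator.mp ha' ⟨y, hy⟩)).1)
      · have ha' : a ∈ f N' := h ▸ ha
        exact congr(($(Module.mem_annihilator.mp ha' ⟨y, hy⟩)).1)
  exact ⟨hf.wellFoundedLT.wf⟩

theorem isQuasidualizing (hι : IsInjectiveHull ι) : IsQuasidualizing R E where
  isArtinian := hι.isArtinian
  homothety_bijective := by
    have := hι.isArtinian
    -- Completeness identifies `R` with its completion, turning the homothety map into the scalar
    -- action.
    have hcomp : completionHomothety R E ∘ AdicCompletion.of (maximalIdeal R) R =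
        LinearMap.lsmul R E := by
      ext r y
      obtain ⟨n, hn⟩ := exists_maximalIdeal_pow_le_ker (R := R) y
      exact completionSMul_eq _ y n r (fun a ha => hn ha)
        (AdicCompletion.evalₐ_of (maximalIdeal R) n r)
    rw [← Function.Bijective.of_comp_iff _ (AdicCompletion.of_bijective (maximalIdeal R) R), hcomp]
    exact hι.lsmul_bijective
  ext_subsingleton i hi := by
    obtain ⟨i, rfl⟩ := Nat.exists_eq_add_of_le' hi
    have := hι.module_injective
    have : Injective (ModuleCat.of R E) := Module.injective_object_of_injective_module R E
    exact subsingleton_of_forall_eq 0 fun x => Abelian.Ext.eq_zero_of_injective x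

end IsInjectiveHull

theorem proposition2p3 (R : Type u) [CommRing R] [IsLocalRing R] [IsNoetherianRing R]
    [IsAdicComplete (IsLocalRing.maximalIdeal R) R]
    (hGorenstein : CategoryTheory.injectiveDimension (ModuleCat.of R R) < ⊤)
    (hdim : 0 < ringKrullDim R) :
    -- `E(R/𝔮) ⊗ E(k) = 0`
    (∀ (q : Ideal R), q.IsPrime → 0 < q.height →
      ∀ (E : Type u) [AddCommGroup E] [Module R E] (ι : (R ⧸ q) →ₗ[R] E)
        (F : Type u) [AddCommGroup F] [Module R F]
        (κ : IsLocalRing.ResidueField R →ₗ[R] F),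
        IsInjectiveHull ι → IsInjectiveHull κ → Subsingleton (E ⊗[R] F)) ∧
    -- over `R`, `T ⊗ L = 0` with `T` quasidualizing does not imply `L = 0`
    (¬ ∀ (T : Type u) [AddCommGroup T] [Module R T] (L : Type u) [AddCommGroup L] [Module R L],
        IsQuasidualizing R T → Subsingleton (T ⊗[R] L) → Subsingleton L) := by
  refine ⟨fun q _ hq E _ _ ι F _ _ κ hι hκ =>
    hι.subsingleton_tensorProduct hGorenstein hq (LinearEquiv.refl R _) hκ.module_injective,
    fun H => ?_⟩
  obtain ⟨E, _, _, ι, hι⟩ := exists_isInjectiveHull (R := R) (ResidueField R)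
  have hm : 0 < (maximalIdeal R).height := by
    rw [← maximalIdeal_height_eq_ringKrullDim] at hdim
    exact_mod_cast hdim
  have hsub : Subsingleton (E ⊗[R] E) := hι.subsingleton_tensorProduct hGorenstein hm
    (LinearEquiv.refl R (ResidueField R)) hι.module_injective
  exact hι.apply_one_ne_zero ((H E E hι.isQuasidualizing hsub).elim _ _)
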